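/- Let $0<q<1$. Write $(z;q)_\infty=\prod_{i=0}^{\infty}(1-zq^{i})$ for $z\in\mathbb{C}$, and let $$\Gamma_q(x)=\frac{(q;q)_\infty}{(q^{x};q)_\infty}\,(1-q)^{1-x}$$ denote the $q$-Gamma function. Let $m,n\in\mathbb{N}$ and let $\alpha_{k,1,\ell},\alpha_{k,2,\ell}>0$ be real numbers for $1\le k\le n$, $1\le\ell\le m$. Then the $n\times n$ matrix $$\left(\prod_{\ell=1}^{m}\frac{\Gamma_{q}(\alpha_{j,1,\ell}+\alpha_{k,1,\ell})\,\Gamma_{q}(\alpha_{j,2,\ell}+\alpha_{k,2,\ell})}{\Gamma_{q}(\alpha_{j,1,\ell}+\alpha_{j,2,\ell}+\alpha_{k,1,\ell}+\alpha_{k,2,\ell})}\right)_{j,k=1}^{n}$$ is positive semidefinite, that is, $\sum_{j,k=1}^{n}a_{j,k}z_j\overline{z_k}\ge 0$ for all $z_1,\dots,z_n\in\mathbb{C}$, where $a_{j,k}$ denotes its $(j,k)$ entry. -/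

import Mathlib

open scoped ComplexOrder

noncomputable section

/-- The infinite `q`-shifted factorial `(z; q)_∞ = ∏_{n ≥ 0} (1 - z q ^ n)`. -/
def qPochhammerInf (z : ℂ) (q : ℝ) : ℂ :=
  ∏' n : ℕ, (1 - z * (q : ℂ) ^ n)

/-- The `q`-Gamma function `Γ_q(z) = (q; q)_∞ / (q ^ z; q)_∞ * (1 - q) ^ (1 - z)`
for `0 < q < 1`. -/
def qGamma (q : ℝ) (z : ℂ) : ℂ :=
  qPochhammerInf (q : ℂ) q / qPochhammerInf ((q : ℂ) ^ z) q * (1 - (q : ℂ)) ^ (1 - z)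

end

/-! Entrywise products of positive semidefinite matrices are positive semidefinite (Schur), so one
factor `l` suffices. In `qGamma_mul_div_qGamma` the powers of `1 - q` collapse, leaving a
nonnegative constant times `(uv; q)_∞ / ((u; q)_∞ (v; q)_∞)` with `u = x j * x k`, `v = y j * y k`,
`x = q ^ a`, `y = q ^ b`. The `q`-binomial theorem expands this quotient (`hasSum_qBeta`) as the sum
of `u ^ n / ((q; q)_n (v q ^ n; q)_∞)`. Here `u ^ n` is a rank-one kernel, and the reciprocal
infinite product is a limit of products of geometric series in the rank-one kernel `v`. Nonnegative
sums, Schur products and limits preserve positivity. -/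

open Filter Topology Finset

/-- The finite `q`-shifted factorial `(z; q)_N = ∏_{i < N} (1 - z q ^ i)`. -/
def qPochhammerFin (z : ℂ) (q : ℝ) (N : ℕ) : ℂ :=
  ∏ i ∈ range N, (1 - z * (q : ℂ) ^ i)

/-! ### Infinite products and the `q`-binomial theorem. -/

section qPochhammer

variable {q : ℝ}

lemma norm_ofReal_lt_one (hq0 : 0 < q) (hq1 : q < 1) : ‖(q : ℂ)‖ < 1 := by
  simpa [abs_of_pos hq0] using hq1

lemma summable_norm_neg_mul_pow (hq0 : 0 < q) (hq1 : q < 1) (z : ℂ) :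
    Summable fun i : ℕ => ‖-(z * (q : ℂ) ^ i)‖ := by
  simp only [norm_neg, norm_mul, norm_pow]
  exact (summable_geometric_of_lt_one (norm_nonneg _) (norm_ofReal_lt_one hq0 hq1)).mul_left _

lemma multipliable_one_sub_mul_pow (hq0 : 0 < q) (hq1 : q < 1) (z : ℂ) :
    Multipliable fun i : ℕ => 1 - z * (q : ℂ) ^ i := by
  simpa [sub_eq_add_neg] using
    multipliable_one_add_of_summable (summable_norm_neg_mul_pow hq0 hq1 z)

lemma tendsto_qPochhammerFin (hq0 : 0 < q) (hq1 : q < 1) (z : ℂ) :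
    Tendsto (qPochhammerFin z q) atTop (𝓝 (qPochhammerInf z q)) :=
  (multipliable_one_sub_mul_pow hq0 hq1 z).tendsto_prod_tprod_nat

lemma one_sub_mul_pow_ne_zero (hq0 : 0 < q) (hq1 : q < 1) {z : ℂ} (hz : ‖z‖ < 1) (i : ℕ) :
    1 - z * (q : ℂ) ^ i ≠ 0 := by
  intro h
  have h1 : ‖z * (q : ℂ) ^ i‖ = 1 := by rw [← sub_eq_zero.mp h, norm_one]
  rw [norm_mul, norm_pow] at h1
  have h2 : ‖(q : ℂ)‖ ^ i ≤ 1 := pow_le_one₀ (norm_nonneg _) (norm_ofReal_lt_one hq0 hq1).le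
  nlinarith [norm_nonneg z]

lemma qPochhammerFin_ne_zero (hq0 : 0 < q) (hq1 : q < 1) {z : ℂ} (hz : ‖z‖ < 1) (N : ℕ) :
    qPochhammerFin z q N ≠ 0 :=
  prod_ne_zero_iff.mpr fun i _ => one_sub_mul_pow_ne_zero hq0 hq1 hz i

lemma qPochhammerInf_ne_zero (hq0 : 0 < q) (hq1 : q < 1) {z : ℂ} (hz : ‖z‖ < 1) :
    qPochhammerInf z q ≠ 0 := by
  have := tprod_one_add_ne_zero_of_summable (f := fun i : ℕ => -(z * (q : ℂ) ^ i))
    (fun i => by simpa [sub_eq_add_neg] using one_sub_mul_pow_ne_zero hq0 hq1 hz i)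
    (summable_norm_neg_mul_pow hq0 hq1 z)
  simpa [qPochhammerInf, sub_eq_add_neg] using this

lemma qPochhammerFin_succ (z : ℂ) (q : ℝ) (N : ℕ) :
    qPochhammerFin z q (N + 1) = qPochhammerFin z q N * (1 - z * (q : ℂ) ^ N) :=
  prod_range_succ _ _

lemma qPochhammerFin_add (z : ℂ) (q : ℝ) (n N : ℕ) :
    qPochhammerFin z q (n + N) = qPochhammerFin z q n * qPochhammerFin (z * (q : ℂ) ^ n) q N := by
  simp only [qPochhammerFin, prod_range_add, pow_add, mul_assoc]

lemma qPochhammerFin_mul_qPochhammerInf (hq0 : 0 < q) (hq1 : q < 1) (z : ℂ) (n : ℕ) :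
    qPochhammerFin z q n * qPochhammerInf (z * (q : ℂ) ^ n) q = qPochhammerInf z q := by
  have h1 := (tendsto_qPochhammerFin hq0 hq1 (z * (q : ℂ) ^ n)).const_mul (qPochhammerFin z q n)
  have h2 := (tendsto_add_atTop_iff_nat n).mpr (tendsto_qPochhammerFin hq0 hq1 z)
  refine tendsto_nhds_unique h1 (h2.congr fun N => ?_)
  rw [add_comm N n, qPochhammerFin_add]

lemma qPochhammerFin_self_nonneg (hq0 : 0 < q) (hq1 : q < 1) (N : ℕ) :
    0 ≤ qPochhammerFin q q N := by
  refine prod_nonneg fun i _ => ?_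
  have : (0 : ℝ) ≤ 1 - q * q ^ i := by
    have := pow_le_one₀ (n := i + 1) hq0.le hq1.le
    rw [pow_succ'] at this
    linarith
  exact_mod_cast Complex.zero_le_real.mpr this

lemma qPochhammerInf_self_nonneg (hq0 : 0 < q) (hq1 : q < 1) : 0 ≤ qPochhammerInf q q :=
  ge_of_tendsto' (tendsto_qPochhammerFin hq0 hq1 q) (qPochhammerFin_self_nonneg hq0 hq1)

/-- The coefficient `(v; q)_n / (q; q)_n` of the `q`-binomial series. -/
noncomputable def qBinomialCoeff (v : ℂ) (q : ℝ) (n : ℕ) : ℂ :=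
  qPochhammerFin v q n / qPochhammerFin q q n

lemma qBinomialCoeff_zero (v : ℂ) (q : ℝ) : qBinomialCoeff v q 0 = 1 := by
  simp [qBinomialCoeff, qPochhammerFin]

lemma qBinomialCoeff_succ (hq0 : 0 < q) (hq1 : q < 1) (v : ℂ) (n : ℕ) :
    qBinomialCoeff v q (n + 1) * (1 - (q : ℂ) ^ (n + 1)) =
      qBinomialCoeff v q n * (1 - v * (q : ℂ) ^ n) := by
  have h1 := qPochhammerFin_ne_zero hq0 hq1 (norm_ofReal_lt_one hq0 hq1) n
  have h2 := one_sub_mul_pow_ne_zero hq0 hq1 (norm_ofReal_lt_one hq0 hq1) n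
  rw [qBinomialCoeff, qBinomialCoeff, qPochhammerFin_succ, qPochhammerFin_succ, pow_succ']
  generalize 1 - (q : ℂ) * (q : ℂ) ^ n = d at *
  field_simp

/-- The coefficients converge to `(v; q)_∞ / (q; q)_∞`, hence are bounded; the series is then
dominated by a geometric one. -/
lemma exists_norm_qBinomialCoeff_le (hq0 : 0 < q) (hq1 : q < 1) (v : ℂ) :
    ∃ C, ∀ n, ‖qBinomialCoeff v q n‖ ≤ C := by
  have h : Tendsto (qBinomialCoeff v q) atTop _ := (tendsto_qPochhammerFin hq0 hq1 v).div
    (tendsto_qPochhammerFin hq0 hq1 q)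
    (qPochhammerInf_ne_zero hq0 hq1 (norm_ofReal_lt_one hq0 hq1))
  obtain ⟨C, hC⟩ := (Metric.isBounded_range_of_tendsto _ h).exists_norm_le
  exact ⟨C, fun n => hC _ ⟨n, rfl⟩⟩

lemma summable_norm_qBinomial (hq0 : 0 < q) (hq1 : q < 1) (v : ℂ) {u : ℂ} (hu : ‖u‖ < 1) :
    Summable fun n => ‖qBinomialCoeff v q n * u ^ n‖ := by
  obtain ⟨C, hC⟩ := exists_norm_qBinomialCoeff_le hq0 hq1 v
  refine Summable.of_nonneg_of_le (fun _ => norm_nonneg _) (fun n => ?_)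
    ((summable_geometric_of_lt_one (norm_nonneg u) hu).mul_left C)
  rw [norm_mul, norm_pow]
  exact mul_le_mul_of_nonneg_right (hC n) (by positivity)

/-- The `q`-binomial series `∑ (v; q)_n / (q; q)_n u ^ n`. -/
noncomputable def qBinomialSeries (v : ℂ) (q : ℝ) (u : ℂ) : ℂ := ∑' n, qBinomialCoeff v q n * u ^ n

lemma norm_mul_pow_lt_one (hq0 : 0 < q) (hq1 : q < 1) {u : ℂ} (hu : ‖u‖ < 1) (N : ℕ) :
    ‖u * (q : ℂ) ^ N‖ < 1 := by
  rw [norm_mul, norm_pow]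
  exact (mul_le_of_le_one_right (norm_nonneg _)
    (pow_le_one₀ (norm_nonneg _) (norm_ofReal_lt_one hq0 hq1).le)).trans_lt hu

/-- Comparing coefficients of `u ^ (n + 1)` reduces this to the recursion `qBinomialCoeff_succ`.
Iterating it moves the argument towards `0`, where the series is `1`. -/
lemma qBinomialSeries_functional (hq0 : 0 < q) (hq1 : q < 1) (v : ℂ) {u : ℂ} (hu : ‖u‖ < 1) :
    (1 - u) * qBinomialSeries v q u = (1 - u * v) * qBinomialSeries v q (u * q) := by
  have hf := (summable_norm_qBinomial hq0 hq1 v hu).of_norm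
  have hg := (summable_norm_qBinomial hq0 hq1 v
    (by simpa using norm_mul_pow_lt_one hq0 hq1 hu 1 : ‖u * (q : ℂ)‖ < 1)).of_norm
  have hf' := (summable_nat_add_iff 1).mpr hf
  have hg' := (summable_nat_add_iff 1).mpr hg
  have key : (∑' n, qBinomialCoeff v q (n + 1) * u ^ (n + 1)) - u * qBinomialSeries v q u =
      (∑' n, qBinomialCoeff v q (n + 1) * (u * q) ^ (n + 1))
        - u * v * qBinomialSeries v q (u * q) := by
    rw [qBinomialSeries, qBinomialSeries, ← tsum_mul_left, ← tsum_mul_left,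
      ← hf'.tsum_sub (hf.mul_left u), ← hg'.tsum_sub (hg.mul_left (u * v))]
    refine tsum_congr fun n => ?_
    have := qBinomialCoeff_succ hq0 hq1 v n
    simp only [mul_pow]
    linear_combination u ^ (n + 1) * this
  have e1 : qBinomialSeries v q u = 1 + ∑' n, qBinomialCoeff v q (n + 1) * u ^ (n + 1) := by
    rw [qBinomialSeries, hf.tsum_eq_zero_add, qBinomialCoeff_zero, pow_zero, mul_one]
  have e2 : qBinomialSeries v q (u * q) =
      1 + ∑' n, qBinomialCoeff v q (n + 1) * (u * q) ^ (n + 1) := by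
    rw [qBinomialSeries, hg.tsum_eq_zero_add, qBinomialCoeff_zero, pow_zero, mul_one]
  linear_combination e1 - e2 + key

lemma qBinomialSeries_iterate (hq0 : 0 < q) (hq1 : q < 1) (v : ℂ) {u : ℂ} (hu : ‖u‖ < 1) (N : ℕ) :
    qPochhammerFin u q N * qBinomialSeries v q u =
      qPochhammerFin (u * v) q N * qBinomialSeries v q (u * (q : ℂ) ^ N) := by
  induction N with
  | zero => simp [qPochhammerFin]
  | succ N ih =>
    have h := qBinomialSeries_functional hq0 hq1 v (norm_mul_pow_lt_one hq0 hq1 hu N)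
    rw [mul_assoc u _ (q : ℂ), ← pow_succ] at h
    rw [qPochhammerFin_succ, qPochhammerFin_succ]
    linear_combination (1 - u * (q : ℂ) ^ N) * ih + qPochhammerFin (u * v) q N * h

lemma tendsto_qBinomialSeries (hq0 : 0 < q) (hq1 : q < 1) (v : ℂ) {u : ℂ} (hu : ‖u‖ < 1) :
    Tendsto (fun N : ℕ => qBinomialSeries v q (u * (q : ℂ) ^ N)) atTop (𝓝 1) := by
  have hq := tendsto_pow_atTop_nhds_zero_of_norm_lt_one (norm_ofReal_lt_one hq0 hq1)
  have h0 : ∑' n, qBinomialCoeff v q n * (0 : ℂ) ^ n = 1 := by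
    rw [tsum_eq_single 0 (by intro n hn; simp [hn])]
    simp [qBinomialCoeff_zero]
  rw [← h0]
  refine tendsto_tsum_of_dominated_convergence (summable_norm_qBinomial hq0 hq1 v hu)
    (fun n => ?_) (Eventually.of_forall fun N n => ?_)
  · have h := ((hq.const_mul u).pow n).const_mul (qBinomialCoeff v q n)
    rwa [mul_zero] at h
  · rw [norm_mul, norm_mul, norm_pow, norm_pow, norm_mul, norm_pow]
    gcongr
    exact mul_le_of_le_one_right (norm_nonneg _)
      (pow_le_one₀ (norm_nonneg _) (norm_ofReal_lt_one hq0 hq1).le)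

/-- The `q`-binomial theorem. -/
theorem qPochhammerInf_mul_qBinomialSeries (hq0 : 0 < q) (hq1 : q < 1) (v : ℂ) {u : ℂ}
    (hu : ‖u‖ < 1) :
    qPochhammerInf u q * qBinomialSeries v q u = qPochhammerInf (u * v) q := by
  have h1 := (tendsto_qPochhammerFin hq0 hq1 u).mul_const (qBinomialSeries v q u)
  have h2 := (tendsto_qPochhammerFin hq0 hq1 (u * v)).mul (tendsto_qBinomialSeries hq0 hq1 v hu)
  rw [mul_one] at h2
  exact tendsto_nhds_unique h1 (h2.congr fun N => (qBinomialSeries_iterate hq0 hq1 v hu N).symm)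

/-- Expansion of the quotient of infinite products occurring in the `q`-Beta function. -/
theorem hasSum_qBeta (hq0 : 0 < q) (hq1 : q < 1) {u v : ℂ} (hu : ‖u‖ < 1) (hv : ‖v‖ < 1) :
    HasSum (fun n : ℕ => (qPochhammerFin q q n)⁻¹ *
        (u ^ n * (qPochhammerInf (v * (q : ℂ) ^ n) q)⁻¹))
      (qPochhammerInf (u * v) q / (qPochhammerInf u q * qPochhammerInf v q)) := by
  have hU := qPochhammerInf_ne_zero hq0 hq1 hu
  have hV := qPochhammerInf_ne_zero hq0 hq1 hv
  have h := ((summable_norm_qBinomial hq0 hq1 v hu).of_norm.hasSum).mul_left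
    (qPochhammerInf v q)⁻¹
  change HasSum _ (_ * qBinomialSeries v q u) at h
  convert h using 1
  · ext n
    -- Splitting off `n` factors turns `(v; q)_n / (v; q)_∞` into `1 / (v q ^ n; q)_∞`.
    have h1 := qPochhammerFin_mul_qPochhammerInf hq0 hq1 v n
    have h2 := qPochhammerFin_ne_zero hq0 hq1 hv n
    rw [← h1, qBinomialCoeff, mul_inv]
    field_simp
  · rw [← qPochhammerInf_mul_qBinomialSeries hq0 hq1 v hu]
    field_simp

end qPochhammer

/-! ### Positive semidefinite kernels: limits, Schur products, infinite products. -/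

section PosSemidef

variable {ι : Type*} [Fintype ι]

lemma Matrix.PosSemidef.of_tendsto {A : ℕ → Matrix ι ι ℂ} {B : Matrix ι ι ℂ}
    (hA : ∀ N, (A N).PosSemidef)
    (h : ∀ j k, Tendsto (fun N => A N j k) atTop (𝓝 (B j k))) : B.PosSemidef := by
  refine .of_dotProduct_mulVec_nonneg (Matrix.IsHermitian.ext fun j k => ?_) fun x => ?_
  · exact tendsto_nhds_unique ((h k j).star.congr fun N => (hA N).isHermitian.apply j k) (h j k)
  · refine ge_of_tendsto' (f := fun N => star x ⬝ᵥ (A N).mulVec x) (b := 0) (x := atTop) ?_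
      fun N => (hA N).dotProduct_mulVec_nonneg x
    simp only [dotProduct, Matrix.mulVec]
    exact tendsto_finsetSum _ fun j _ => (tendsto_finsetSum _ fun k _ =>
      (h j k).mul_const _).const_mul _

lemma Matrix.PosSemidef.of_hasSum {A : ℕ → Matrix ι ι ℂ} {B : Matrix ι ι ℂ}
    (hA : ∀ n, (A n).PosSemidef) (h : ∀ j k, HasSum (fun n => A n j k) (B j k)) :
    B.PosSemidef := by
  refine .of_tendsto (fun N => Matrix.posSemidef_sum (range N) fun n _ => hA n) fun j k => ?_
  simpa only [Matrix.sum_apply] using (h j k).tendsto_sum_nat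

lemma Matrix.PosSemidef.of_prod {κ : Type*} (s : Finset κ) {A : κ → ι → ι → ℂ}
    (hA : ∀ i ∈ s, (Matrix.of (A i)).PosSemidef) :
    (Matrix.of fun j k => ∏ i ∈ s, A i j k).PosSemidef := by
  classical
  induction s using Finset.induction_on with
  | empty =>
    -- The empty product is the all-ones matrix, which has rank one.
    convert Matrix.posSemidef_vecMulVec_self_star (fun _ : ι => (1 : ℂ)) using 1
    ext j k
    simp [Matrix.vecMulVec_apply]
  | insert i s hi ih =>
    have h : (Matrix.of fun j k => ∏ i' ∈ insert i s, A i' j k) =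
        (Matrix.of (A i)).hadamard (Matrix.of fun j k => ∏ i' ∈ s, A i' j k) := by
      ext j k
      simp [prod_insert hi]
    rw [h]
    exact (hA i (mem_insert_self i s)).hadamard (ih fun i' hi' => hA i' (mem_insert_of_mem hi'))

lemma posSemidef_ofReal_mul (w : ι → ℝ) :
    (Matrix.of fun j k => (w j : ℂ) * (w k : ℂ)).PosSemidef := by
  convert Matrix.posSemidef_vecMulVec_self_star (fun j => (w j : ℂ)) using 1
  ext j k
  simp [Matrix.vecMulVec_apply]

lemma posSemidef_pow (w : ι → ℝ) (n : ℕ) :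
    (Matrix.of fun j k => ((w j : ℂ) * (w k : ℂ)) ^ n).PosSemidef := by
  simpa using Matrix.PosSemidef.of_prod (range n) fun _ _ => posSemidef_ofReal_mul w

/-- The geometric series has nonnegative coefficients `c ^ n` on Schur powers of a rank-one kernel.
The free `c` absorbs the shifts `q ^ (n + i)` of the infinite product. -/
lemma posSemidef_inv_one_sub (w : ι → ℝ) {c : ℝ} (hc : 0 ≤ c)
    (h : ∀ j k, ‖(w j : ℂ) * (w k : ℂ) * c‖ < 1) :
    (Matrix.of fun j k => (1 - (w j : ℂ) * (w k : ℂ) * c)⁻¹).PosSemidef := by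
  refine .of_hasSum (A := fun n => ((c : ℂ) ^ n) • Matrix.of fun j k =>
    ((w j : ℂ) * (w k : ℂ)) ^ n) (fun n => (posSemidef_pow w n).smul ?_) fun j k => ?_
  · exact pow_nonneg (Complex.zero_le_real.mpr hc) n
  · convert! hasSum_geometric_of_norm_lt_one (h j k) using 1
    ext n
    rw [Matrix.smul_apply, Matrix.of_apply, smul_eq_mul, mul_pow _ (c : ℂ), mul_comm]

lemma posSemidef_inv_qPochhammerInf {q : ℝ} (hq0 : 0 < q) (hq1 : q < 1) (w : ι → ℝ)
    (h : ∀ j k, ‖(w j : ℂ) * (w k : ℂ)‖ < 1) (n : ℕ) :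
    (Matrix.of fun j k =>
      (qPochhammerInf ((w j : ℂ) * (w k : ℂ) * (q : ℂ) ^ n) q)⁻¹).PosSemidef := by
  refine .of_tendsto (A := fun N => Matrix.of fun j k =>
      ∏ i ∈ range N, (1 - (w j : ℂ) * (w k : ℂ) * ((q ^ (n + i) : ℝ) : ℂ))⁻¹)
    (fun N => .of_prod _ fun i _ => posSemidef_inv_one_sub w (by positivity) fun j k => ?_)
    fun j k => ?_
  · simpa using norm_mul_pow_lt_one hq0 hq1 (h j k) (n + i)
  · refine ((tendsto_qPochhammerFin hq0 hq1 _).inv₀ (qPochhammerInf_ne_zero hq0 hq1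
      (norm_mul_pow_lt_one hq0 hq1 (h j k) n))).congr fun N => ?_
    simp [qPochhammerFin, pow_add, mul_assoc]

lemma posSemidef_qPochhammerInf_quotient {q : ℝ} (hq0 : 0 < q) (hq1 : q < 1) (x y : ι → ℝ)
    (hx : ∀ j k, ‖(x j : ℂ) * (x k : ℂ)‖ < 1) (hy : ∀ j k, ‖(y j : ℂ) * (y k : ℂ)‖ < 1) :
    (Matrix.of fun j k => qPochhammerInf ((x j : ℂ) * x k * (y j * y k)) q /
      (qPochhammerInf ((x j : ℂ) * x k) q * qPochhammerInf ((y j : ℂ) * y k) q)).PosSemidef := by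
  refine .of_hasSum (fun n => ((posSemidef_pow x n).hadamard
    (posSemidef_inv_qPochhammerInf hq0 hq1 y hy n)).smul
      (inv_nonneg.mpr (qPochhammerFin_self_nonneg hq0 hq1 n))) fun j k => ?_
  simpa using hasSum_qBeta hq0 hq1 (hx j k) (hy j k)

end PosSemidef

/-! ### From the `q`-Beta kernel to the theorem. -/

lemma qGamma_mul_div_qGamma {q : ℝ} (hq0 : 0 < q) (hq1 : q < 1) (a b : ℂ) :
    qGamma q a * qGamma q b / qGamma q (a + b) =
      (1 - (q : ℂ)) * qPochhammerInf q q * (qPochhammerInf ((q : ℂ) ^ a * (q : ℂ) ^ b) q /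
        (qPochhammerInf ((q : ℂ) ^ a) q * qPochhammerInf ((q : ℂ) ^ b) q)) := by
  have hq : (q : ℂ) ≠ 0 := by exact_mod_cast hq0.ne'
  have hq' : (1 : ℂ) - q ≠ 0 := by
    rw [sub_ne_zero]
    exact_mod_cast hq1.ne'
  have hQ := qPochhammerInf_ne_zero hq0 hq1 (norm_ofReal_lt_one hq0 hq1)
  have hpow : (1 - (q : ℂ)) ^ (1 - a) * (1 - (q : ℂ)) ^ (1 - b) =
      (1 - (q : ℂ)) * (1 - (q : ℂ)) ^ (1 - (a + b)) := by
    rw [← Complex.cpow_add _ _ hq', show 1 - a + (1 - b) = 1 + (1 - (a + b)) by ring,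
      Complex.cpow_add _ _ hq', Complex.cpow_one]
  have hne : (1 - (q : ℂ)) ^ (1 - (a + b)) ≠ 0 := by simp [Complex.cpow_eq_zero_iff, hq']
  simp only [qGamma, Complex.cpow_add _ _ hq]
  generalize (1 - (q : ℂ)) ^ (1 - a) = A at *
  generalize (1 - (q : ℂ)) ^ (1 - b) = B at *
  generalize (1 - (q : ℂ)) ^ (1 - (a + b)) = C at *
  generalize qPochhammerInf (q : ℂ) q = Q at *
  generalize qPochhammerInf ((q : ℂ) ^ a * (q : ℂ) ^ b) q = P
  generalize qPochhammerInf ((q : ℂ) ^ a) q = U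
  generalize qPochhammerInf ((q : ℂ) ^ b) q = V
  -- Only `Q` and `C` get cancelled, so no nonvanishing of `P`, `U` or `V` is needed and `a`, `b`
  -- may be arbitrary.
  calc Q / U * A * (Q / V * B) / (Q / P * C)
      = A * B * (Q * Q⁻¹) * Q * C⁻¹ * (P / (U * V)) := by
        simp only [div_eq_mul_inv, mul_inv, inv_inv]
        ring
    _ = (1 - (q : ℂ)) * Q * (P / (U * V)) * (C * C⁻¹) := by
        rw [hpow, mul_inv_cancel₀ hQ]
        ring
    _ = _ := by rw [mul_inv_cancel₀ hne, mul_one]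

lemma posSemidef_qBeta {ι : Type*} [Fintype ι] {q : ℝ} (hq0 : 0 < q) (hq1 : q < 1) (a b : ι → ℝ)
    (ha : ∀ k, 0 < a k) (hb : ∀ k, 0 < b k) :
    (Matrix.of fun j k : ι => qGamma q (a j + a k) * qGamma q (b j + b k) /
      qGamma q (a j + b j + a k + b k)).PosSemidef := by
  have hq : (q : ℂ) ≠ 0 := by exact_mod_cast hq0.ne'
  have hcast : ∀ t : ℝ, (q : ℂ) ^ (t : ℂ) = ((q ^ t : ℝ) : ℂ) := fun t =>
    (Complex.ofReal_cpow hq0.le t).symm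
  have hnorm : ∀ c : ι → ℝ, (∀ k, 0 < c k) → ∀ j k,
      ‖((q ^ c j : ℝ) : ℂ) * ((q ^ c k : ℝ) : ℂ)‖ < 1 := by
    intro c hc j k
    rw [← Complex.ofReal_mul, ← Real.rpow_add hq0, Complex.norm_real, Real.norm_eq_abs,
      abs_of_pos (Real.rpow_pos_of_pos hq0 _)]
    exact Real.rpow_lt_one hq0.le hq1 (add_pos (hc j) (hc k))
  have hconst : 0 ≤ (1 - (q : ℂ)) * qPochhammerInf q q := by
    refine mul_nonneg ?_ (qPochhammerInf_self_nonneg hq0 hq1)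
    exact_mod_cast Complex.zero_le_real.mpr (sub_nonneg.mpr hq1.le)
  convert (posSemidef_qPochhammerInf_quotient hq0 hq1 (fun j => q ^ a j) (fun j => q ^ b j)
    (hnorm a ha) (hnorm b hb)).smul hconst using 1
  ext j k
  have e : (a j + b j + a k + b k : ℂ) = (a j + a k) + (b j + b k) := by ring
  simp only [Matrix.of_apply, Matrix.smul_apply, smul_eq_mul]
  rw [e, qGamma_mul_div_qGamma hq0 hq1, Complex.cpow_add _ _ hq, Complex.cpow_add _ _ hq]
  simp only [hcast]

theorem mainTheorem8 (q : ℝ) (hq0 : 0 < q) (hq1 : q < 1) (m n : ℕ)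
    (α₁ α₂ : Fin n → Fin m → ℝ)
    (hα₁ : ∀ k l, 0 < α₁ k l) (hα₂ : ∀ k l, 0 < α₂ k l) :
    (Matrix.of fun j k : Fin n =>
      ∏ l : Fin m,
        qGamma q (α₁ j l + α₁ k l) * qGamma q (α₂ j l + α₂ k l) /
          qGamma q (α₁ j l + α₂ j l + α₁ k l + α₂ k l)).PosSemidef :=
  Matrix.PosSemidef.of_prod univ fun l _ =>
    posSemidef_qBeta hq0 hq1 (fun k => α₁ k l) (fun k => α₂ k l) (fun k => hα₁ k l)
      fun k => hα₂ k l
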